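/- Let $(a_t)_{t\ge 1}$ be a sequence of independent, identically distributed random variables with values in $\{0,1\}$ and $P(a_t=1)=p$, where $0<p<1$, and let $m\ge 1$ be a fixed integer. For $n\ge 1$ put $\bar a=\frac1n\sum_{t=1}^n a_t$ and $$\hat\gamma_a(h)=\frac1n\sum_{t=1+h}^{n}(a_t-\bar a)(a_{t-h}-\bar a),\qquad 0\le h\le m,$$ and let $$\widehat A_m=\left(\frac{\hat\gamma_a(1)}{\hat\gamma_a(0)},\dots,\frac{\hat\gamma_a(m)}{\hat\gamma_a(0)}\right)',\qquad \mathcal S_m^{(a)}=n\,\widehat A_m'\widehat A_m ,$$ where the ratios are set to $0$ on the event $\hat\gamma_a(0)=0$, whose probability tends to $0$. Then, as $n\to\infty$, $$\sqrt n\,\widehat A_m\stackrel{d}{\longrightarrow}\mathcal N(0,I_m)\qquad\text{and}\qquad \mathcal S_m^{(a)}\stackrel{d}{\longrightarrow}\chi^2_m,$$ where $I_m$ is the $m\times m$ identity matrix and $\chi^2_m$ is the chi-squared distribution with $m$ degrees of freedom. -/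

import Mathlib

open MeasureTheory ProbabilityTheory Filter
open scoped Matrix

/-- The sample mean `x̄ = n⁻¹ ∑_{t=1}^{n} x_t` of the observations `x_1, …, x_n`
(the value `x 0` is never used). -/
noncomputable def sampleMean (x : ℕ → ℝ) (n : ℕ) : ℝ :=
  (1 / (n : ℝ)) * ∑ t ∈ Finset.Icc 1 n, x t

/-- The sample autocovariance at lag `h` of the observations `x_1, …, x_n`:
`γ̂(h) = n⁻¹ ∑_{t=1+h}^{n} (x_t - x̄) (x_{t-h} - x̄)`.
In the sum `t ≥ 1 + h`, so that the subtraction `t - h` is never truncated. -/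
noncomputable def sampleAutocov (x : ℕ → ℝ) (n h : ℕ) : ℝ :=
  (1 / (n : ℝ)) *
    ∑ t ∈ Finset.Icc (1 + h) n, (x t - sampleMean x n) * (x (t - h) - sampleMean x n)

/-- The vector `Â_m = (γ̂(1)/γ̂(0), …, γ̂(m)/γ̂(0))'`; the coordinate with index `i : Fin m`
is the one of lag `h = i + 1`. -/
noncomputable def autocorrVec (m : ℕ) (x : ℕ → ℝ) (n : ℕ) : EuclideanSpace ℝ (Fin m) :=
  WithLp.toLp 2 fun i : Fin m => sampleAutocov x n (i + 1) / sampleAutocov x n 0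

/-- The portmanteau statistic `S_m = n Â_m' Â_m`. -/
noncomputable def portmanteauStat (m : ℕ) (x : ℕ → ℝ) (n : ℕ) : ℝ :=
  (n : ℝ) * ((autocorrVec m x n).ofLp ⬝ᵥ (autocorrVec m x n).ofLp)

/-- The `χ²` distribution with `m` degrees of freedom: the law of the sum of the squares of `m`
independent standard normal random variables. -/
noncomputable def chiSquaredMeasure (m : ℕ) : Measure ℝ :=
  (Measure.pi fun _ : Fin m => gaussianReal 0 1).map fun z => ∑ i, z i ^ 2

instance isProbabilityMeasure_chiSquaredMeasure (m : ℕ) :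
    IsProbabilityMeasure (chiSquaredMeasure m) :=
  Measure.isProbabilityMeasure_map (Measurable.aemeasurable (by fun_prop))

/-! Autocorrelations are unchanged by affine maps of the data, so `a` may be replaced by
standardized noise `x`: bounded, independent, mean 0, variance 1. Expanding the centred products
gives `n γ̂(h) = ∑ x_t x_{t+h} - n x̄² + O(1)` (`abs_mul_sampleAutocov_sub_le`). As `n E x̄²` is
bounded, `√n γ̂(h)` differs from `n^{-1/2} ∑ x_t x_{t+h}` by a term tending to 0 in probability,
while `γ̂(0) → 1`. Slutsky's theorem reduces normality to that of the lag products, and the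
continuous map `‖·‖²` then gives the `χ²` limit.

For the lag products, fix `u` and put `Y_t = x_t ∑ u_i x_{t+1+i}`. Read backwards in time these are
martingale differences: `x_t` is centred and independent of everything later. McLeish's method
compares `exp(iθ)` with `(1 + iθ) exp(-θ²/2)` at `θ_t = Y_t/√n`. The product of the `1 + iθ_t` has
mean exactly 1 (`integral_prod_one_add_lagCombination`), and `∑ θ_t² → ‖u‖²` in `L¹` because the
`Y_t²` are independent at distance more than `m`. Hence the characteristic functions tend to
`exp(-‖u‖²/2)`. -/

/-! ### Independence of past and future. -/

section Independence

lemma comap_pi_le {Ω : Type*} {𝓕 : MeasurableSpace Ω} {f : Ω → ℕ → ℝ}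
    (h : ∀ j, Measurable fun ω => f ω j) : MeasurableSpace.comap f inferInstance ≤ 𝓕 :=
  (measurable_pi_lambda f h).comap_le

variable {Ω : Type*} [MeasurableSpace Ω] {P : Measure Ω} {x : ℕ → Ω → ℝ}

/-- For an independent sequence, the observations before time `s` (padded with zeros) are
independent of the observations from time `s` on. -/
lemma indepFun_past_future (hm : ∀ i, Measurable (x i)) (hi : iIndepFun x P) (s : ℕ) :
    IndepFun (fun ω (j : ℕ) => if j < s then x j ω else 0) (fun ω (j : ℕ) => x (s + j) ω) P := by
  have hind := indep_iSup_of_disjoint (fun i => (hm i).comap_le) hi.iIndep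
    (S := Set.Iio s) (T := Set.Ici s) (Set.disjoint_left.2 fun j (h : j < s) (h' : s ≤ j) => absurd h h'.not_gt)
  refine indep_of_indep_of_le_left (indep_of_indep_of_le_right hind ?_) ?_
  · refine comap_pi_le fun j => ?_
    have h : MeasurableSpace.comap (x (s + j)) inferInstance ≤
        ⨆ i ∈ Set.Ici s, MeasurableSpace.comap (x i) inferInstance :=
      le_iSup₂_of_le (s + j) (by simp) le_rfl
    exact (comap_measurable (x (s + j))).mono h le_rfl
  · refine comap_pi_le fun j => ?_
    by_cases hj : j < s
    · have h : MeasurableSpace.comap (x j) inferInstance ≤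
          ⨆ i ∈ Set.Iio s, MeasurableSpace.comap (x i) inferInstance :=
        le_iSup₂_of_le j (by simpa using hj) le_rfl
      simpa [hj] using (comap_measurable (x j)).mono h le_rfl
    · simp [hj]

lemma indepFun_now_future (hm : ∀ i, Measurable (x i)) (hi : iIndepFun x P) (k : ℕ) :
    IndepFun (x k) (fun ω (j : ℕ) => x (k + 1 + j) ω) P := by
  have hk : Measurable fun y : ℕ → ℝ => y k := measurable_pi_apply k
  have h := (indepFun_past_future hm hi (k + 1)).comp hk measurable_id
  simpa [Function.comp_def] using h

end Independence

/-! ### Second moments and an `L¹` weak law. -/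

section WeakLaw

variable {Ω : Type*} [MeasurableSpace Ω] {P : Measure Ω} [IsProbabilityMeasure P]

lemma integrable_of_abs_le {f : Ω → ℝ} (hf : Measurable f) {C : ℝ} (hC : ∀ ω, |f ω| ≤ C) :
    Integrable f P :=
  Integrable.of_bound hf.aestronglyMeasurable C (ae_of_all _ hC)

/-- Second moment of a sum of bounded variables which are orthogonal at distance more than `m`. -/
lemma integral_sq_sum_le {Z : ℕ → Ω → ℝ} {C : ℝ} (hm : ∀ t, Measurable (Z t))
    (hb : ∀ t ω, |Z t ω| ≤ C) (m : ℕ)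
    (horth : ∀ s t, s + m < t → ∫ ω, Z s ω * Z t ω ∂P = 0) (n : ℕ) :
    ∫ ω, (∑ t ∈ Finset.range n, Z t ω) ^ 2 ∂P ≤ n * ((2 * m + 1) * C ^ 2) := by
  have hb2 : ∀ s t ω, |Z s ω * Z t ω| ≤ C ^ 2 := fun s t ω => by
    rw [abs_mul, sq]
    exact mul_le_mul (hb s ω) (hb t ω) (abs_nonneg _) ((abs_nonneg _).trans (hb s ω))
  have hint : ∀ s t, Integrable (fun ω => Z s ω * Z t ω) P := fun s t =>
    integrable_of_abs_le ((hm s).mul (hm t)) (hb2 s t)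
  -- Only indices in a window of at most `2m + 1` points around `s` contribute; truncation of `s -
  -- m` at 0 only shortens the window.
  have hle : ∀ s t, ∫ ω, Z s ω * Z t ω ∂P ≤
      if t ∈ Finset.Icc (s - m) (s + m) then C ^ 2 else 0 := by
    intro s t
    split_ifs with h
    · calc ∫ ω, Z s ω * Z t ω ∂P ≤ ∫ _, C ^ 2 ∂P :=
            integral_mono (hint s t) (integrable_const _) fun ω => (le_abs_self _).trans (hb2 s t ω)
        _ = C ^ 2 := by simp
    · rw [Finset.mem_Icc, not_and_or, not_le, not_le] at h
      rcases h with h | h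
      · simp_rw [mul_comm (Z s _)]
        exact (horth t s (by omega)).le
      · exact (horth s t h).le
  simp_rw [sq, Finset.sum_mul_sum]
  rw [integral_finsetSum _ fun s _ => integrable_finsetSum _ fun t _ => hint s t]
  simp_rw [integral_finsetSum _ fun t _ => hint _ t]
  have hrow : ∀ s ∈ Finset.range n, ∑ t ∈ Finset.range n, ∫ ω, Z s ω * Z t ω ∂P ≤
      (2 * m + 1) * C ^ 2 := by
    intro s _
    refine (Finset.sum_le_sum fun t _ => hle s t).trans ?_
    rw [← Finset.sum_filter, Finset.sum_const, nsmul_eq_mul]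
    refine mul_le_mul_of_nonneg_right ?_ (sq_nonneg C)
    have hcard : ((Finset.range n).filter (· ∈ Finset.Icc (s - m) (s + m))).card ≤ 2 * m + 1 := by
      refine (Finset.card_le_card fun t ht => (Finset.mem_filter.1 ht).2).trans ?_
      rw [Nat.card_Icc]
      omega
    exact_mod_cast hcard
  refine (Finset.sum_le_sum hrow).trans ?_
  simp [sq]

/-- Rate form of the weak law: averages of bounded variables orthogonal at distance more than `m`
are `O(n^{-1/2})` in `L¹`. -/
lemma tendsto_integral_abs_average {Z : ℕ → Ω → ℝ} {C : ℝ} (hm : ∀ t, Measurable (Z t))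
    (hb : ∀ t ω, |Z t ω| ≤ C) (m : ℕ)
    (horth : ∀ s t, s + m < t → ∫ ω, Z s ω * Z t ω ∂P = 0) :
    Tendsto (fun n : ℕ => ∫ ω, |(n : ℝ)⁻¹ * ∑ t ∈ Finset.range n, Z t ω| ∂P) atTop (nhds 0) := by
  set D : ℝ := (2 * m + 1) * C ^ 2
  have hbs : ∀ n ω, |∑ t ∈ Finset.range n, Z t ω| ≤ n * C := fun n ω => by
    refine (Finset.abs_sum_le_sum_abs _ _).trans ((Finset.sum_le_sum fun t _ => hb t ω).trans ?_)
    simp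
  have hms : ∀ n, Measurable fun ω => ∑ t ∈ Finset.range n, Z t ω := fun n =>
    Finset.measurable_sum _ fun t _ => hm t
  have hlim : Tendsto (fun n : ℕ => (D + 1) / 2 * (√(n : ℝ))⁻¹) atTop (nhds 0) := by
    simpa using (tendsto_inv_atTop_zero.comp (Real.tendsto_sqrt_atTop.comp
      tendsto_natCast_atTop_atTop)).const_mul ((D + 1) / 2)
  refine tendsto_of_tendsto_of_tendsto_of_le_of_le' tendsto_const_nhds hlim
    (.of_forall fun n => integral_nonneg fun ω => abs_nonneg _) ?_
  filter_upwards [eventually_gt_atTop 0] with n hn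
  have hn' : (0 : ℝ) < n := by exact_mod_cast hn
  have hs : 0 < √(n : ℝ) := Real.sqrt_pos.2 hn'
  have hss : √(n : ℝ) * √(n : ℝ) = n := Real.mul_self_sqrt hn'.le
  have hi2 : Integrable (fun ω => (∑ t ∈ Finset.range n, Z t ω) ^ 2) P :=
    integrable_of_abs_le (C := (n * C) ^ 2) ((hms n).pow_const 2) fun ω => by
      rw [abs_pow]; exact pow_le_pow_left₀ (abs_nonneg _) (hbs n ω) 2
  have hi1 : Integrable (fun ω => |(n : ℝ)⁻¹ * ∑ t ∈ Finset.range n, Z t ω|) P :=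
    (integrable_of_abs_le (C := (n : ℝ)⁻¹ * (n * C)) ((hms n).const_mul _) fun ω => by
      rw [abs_mul, abs_of_pos (inv_pos.2 hn')]
      exact mul_le_mul_of_nonneg_left (hbs n ω) (inv_pos.2 hn').le).abs
  calc ∫ ω, |(n : ℝ)⁻¹ * ∑ t ∈ Finset.range n, Z t ω| ∂P
      ≤ ∫ ω, ((√(n : ℝ))⁻¹ / (2 * n) * (∑ t ∈ Finset.range n, Z t ω) ^ 2
          + (√(n : ℝ))⁻¹ / 2) ∂P := by
        refine integral_mono hi1 ((hi2.const_mul _).add (integrable_const _)) fun ω => ?_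
        set S := ∑ t ∈ Finset.range n, Z t ω
        -- `2|S|√n ≤ S² + n` turns a second moment of order `n` into an `L¹` bound of order
        -- `n^{-1/2}` for `S/n`.
        have h := sq_nonneg (|S| - √(n : ℝ))
        rw [sub_sq, sq_abs, sq (√(n : ℝ)), hss] at h
        have e : (√(n : ℝ))⁻¹ / (2 * n) * S ^ 2 + (√(n : ℝ))⁻¹ / 2 - |(n : ℝ)⁻¹ * S| =
            (√(n : ℝ))⁻¹ / (2 * n) * (S ^ 2 - 2 * |S| * √(n : ℝ) + n) := by
          rw [abs_mul, abs_of_pos (inv_pos.2 hn')]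
          field_simp
          ring
        have : 0 ≤ (√(n : ℝ))⁻¹ / (2 * n) * (S ^ 2 - 2 * |S| * √(n : ℝ) + n) :=
          mul_nonneg (by positivity) h
        show |(n : ℝ)⁻¹ * S| ≤ _
        linarith
    _ = (√(n : ℝ))⁻¹ / (2 * n) * ∫ ω, (∑ t ∈ Finset.range n, Z t ω) ^ 2 ∂P
          + (√(n : ℝ))⁻¹ / 2 := by
        rw [integral_add (hi2.const_mul _) (integrable_const _), integral_const_mul]
        simp
    _ ≤ (√(n : ℝ))⁻¹ / (2 * n) * (n * D) + (√(n : ℝ))⁻¹ / 2 := by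
        gcongr
        exact integral_sq_sum_le hm hb m horth n
    _ = (D + 1) / 2 * (√(n : ℝ))⁻¹ := by
        field_simp

end WeakLaw

/-! ### Elementary exponential estimates. -/

section Estimates

/-- The two expressions agree to second order: `(1 + iθ)(1 - θ²/2)` is `1 + iθ - θ²/2` up to
`iθ³/2`. The errors add up to `1 + 2 · 1/2 + 1/2 ≤ 3` times `|θ|³`. -/
lemma norm_exp_mul_I_sub_le {θ : ℝ} (hθ : |θ| ≤ 1) :
    ‖Complex.exp (θ * Complex.I) - (1 + θ * Complex.I) * Real.exp (-θ ^ 2 / 2)‖ ≤ 3 * |θ| ^ 3 := by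
  have h1 : ‖Complex.exp (θ * Complex.I) - (1 + θ * Complex.I - θ ^ 2 / 2)‖ ≤ |θ| ^ 3 := by
    have hn : ‖(θ : ℂ) * Complex.I‖ = |θ| := by simp
    have h := Complex.exp_bound (x := θ * Complex.I) (by rw [hn]; exact hθ) (n := 3) (by norm_num)
    rw [hn] at h
    have e : ∑ m ∈ Finset.range 3, ((θ : ℂ) * Complex.I) ^ m / (m.factorial : ℂ) =
        1 + θ * Complex.I - θ ^ 2 / 2 := by
      simp [Finset.sum_range_succ, mul_pow, Nat.factorial]
      ring
    rw [e] at h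
    refine h.trans (mul_le_of_le_one_right (by positivity) ?_)
    norm_num [Nat.factorial]
  have h2 : |Real.exp (-θ ^ 2 / 2) - (1 - θ ^ 2 / 2)| ≤ |θ| ^ 3 / 2 := by
    have hle : |(-θ ^ 2 / 2)| ≤ 1 := by
      rw [abs_div, abs_neg, abs_pow, abs_two]
      nlinarith [abs_nonneg θ]
    have h := Real.abs_exp_sub_one_sub_id_le hle
    have e : Real.exp (-θ ^ 2 / 2) - (1 - θ ^ 2 / 2) =
        Real.exp (-θ ^ 2 / 2) - 1 - (-θ ^ 2 / 2) := by ring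
    rw [e]
    refine h.trans ?_
    have e2 : (-θ ^ 2 / 2) ^ 2 = |θ| ^ 3 * |θ| / 4 := by
      rw [← pow_succ, show 3 + 1 = 2 * 2 from rfl, pow_mul, sq_abs]; ring
    rw [e2]
    have : |θ| ^ 3 * |θ| ≤ |θ| ^ 3 * 1 := mul_le_mul_of_nonneg_left hθ (by positivity)
    have : 0 ≤ |θ| ^ 3 := by positivity
    linarith
  have h3 : ‖(1 + θ * Complex.I : ℂ)‖ ≤ 2 := by
    refine (norm_add_le _ _).trans ?_
    simp only [norm_one, Complex.norm_mul, Complex.norm_real, Real.norm_eq_abs, Complex.norm_I,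
      mul_one]
    linarith
  have e : Complex.exp (θ * Complex.I) - (1 + θ * Complex.I) * Real.exp (-θ ^ 2 / 2) =
      (Complex.exp (θ * Complex.I) - (1 + θ * Complex.I - θ ^ 2 / 2))
      + (-((1 + θ * Complex.I) * ((Real.exp (-θ ^ 2 / 2) - (1 - θ ^ 2 / 2) : ℝ) : ℂ)))
      + ((θ ^ 3 / 2 : ℝ) : ℂ) * Complex.I := by
    push_cast
    ring
  rw [e]
  refine (norm_add₃_le).trans ?_
  rw [norm_neg, norm_mul, norm_mul, Complex.norm_real, Complex.norm_real, Complex.norm_I,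
    Real.norm_eq_abs, Real.norm_eq_abs, abs_div, abs_pow, abs_two]
  have h4 := mul_le_mul h3 h2 (abs_nonneg _) (by norm_num)
  have : 0 ≤ |θ| ^ 3 := by positivity
  linarith

/-- Telescoping: factors are exchanged one at a time, the others staying in the unit disc. -/
lemma norm_prod_sub_prod_le_sum {ι : Type*} (s : Finset ι) (z w : ι → ℂ)
    (hz : ∀ i, ‖z i‖ ≤ 1) (hw : ∀ i, ‖w i‖ ≤ 1) :
    ‖∏ i ∈ s, z i - ∏ i ∈ s, w i‖ ≤ ∑ i ∈ s, ‖z i - w i‖ := by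
  classical
  induction s using Finset.induction_on with
  | empty => simp
  | insert a s ha ih =>
    rw [Finset.prod_insert ha, Finset.prod_insert ha, Finset.sum_insert ha]
    have e : z a * ∏ i ∈ s, z i - w a * ∏ i ∈ s, w i =
        (z a - w a) * ∏ i ∈ s, z i + w a * (∏ i ∈ s, z i - ∏ i ∈ s, w i) := by ring
    rw [e]
    refine (norm_add_le _ _).trans ?_
    rw [norm_mul, norm_mul, norm_prod]
    have h1 : ∏ i ∈ s, ‖z i‖ ≤ 1 := Finset.prod_le_one (fun _ _ => norm_nonneg _) fun i _ => hz i
    have h2 := mul_le_mul_of_nonneg_left h1 (norm_nonneg (z a - w a))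
    have h3 := mul_le_mul (hw a) ih (norm_nonneg _) zero_le_one
    linarith

/-- Squared, this is `1 + θ² ≤ exp(θ²)`. It bounds McLeish's product and puts `(1 + iθ) exp(-θ²/2)`
in the unit disc. -/
lemma norm_one_add_mul_I_le (θ : ℝ) : ‖(1 + θ * Complex.I : ℂ)‖ ≤ Real.exp (θ ^ 2 / 2) := by
  refine le_of_sq_le_sq ?_ (Real.exp_pos _).le
  rw [← Complex.normSq_eq_norm_sq, ← Real.exp_nat_mul]
  have e : Complex.normSq (1 + θ * Complex.I) = θ ^ 2 + 1 := by
    simp [Complex.normSq_apply]; ring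
  rw [e, Nat.cast_ofNat, mul_div_cancel₀ _ (two_ne_zero' ℝ)]
  exact Real.add_one_le_exp _

lemma abs_exp_neg_sub_exp_neg_le {a b : ℝ} (ha : 0 ≤ a) (hb : 0 ≤ b) :
    |Real.exp (-a) - Real.exp (-b)| ≤ |a - b| := by
  wlog hab : a ≤ b generalizing a b
  · rw [abs_sub_comm, abs_sub_comm a]
    exact this hb ha (le_of_not_ge hab)
  rw [abs_of_nonneg (sub_nonneg.2 (Real.exp_le_exp.2 (neg_le_neg hab))), abs_sub_comm,
    abs_of_nonneg (sub_nonneg.2 hab)]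
  have h1 : Real.exp (-b) = Real.exp (-a) * Real.exp (a - b) := by
    rw [← Real.exp_add]; ring_nf
  have h2 := Real.add_one_le_exp (a - b)
  have h3 : Real.exp (-a) ≤ 1 := Real.exp_le_one_iff.2 (by linarith)
  have h4 := Real.exp_pos (-a)
  rw [h1]
  nlinarith

end Estimates

/-! ### McLeish's central limit argument. -/

section CentralLimit

variable {Ω : Type*} [MeasurableSpace Ω] {P : Measure Ω} [IsProbabilityMeasure P]

/-- McLeish's argument for the martingale central limit theorem, for a bounded array. -/
lemma norm_exp_sum_sub_prod_le (X : ℕ → ℝ) (B σ2 : ℝ) (hσ : 0 ≤ σ2) (hb : ∀ t, |X t| ≤ B) (n : ℕ)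
    (hn : 0 < n) (hB : B ≤ √(n : ℝ)) :
    ‖Complex.exp (((√(n : ℝ))⁻¹ * ∑ t ∈ Finset.range n, X t : ℝ) * Complex.I)
      - (∏ t ∈ Finset.range n, (1 + ((√(n : ℝ))⁻¹ * X t : ℝ) * Complex.I))
        * Real.exp (-(σ2 / 2))‖ ≤
      3 * B ^ 3 * (√(n : ℝ))⁻¹
        + Real.exp (B ^ 2 / 2) / 2 * |(n : ℝ)⁻¹ * ∑ t ∈ Finset.range n, (X t ^ 2 - σ2)| := by
  have hn' : (0 : ℝ) < n := by exact_mod_cast hn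
  have hs : 0 < √(n : ℝ) := Real.sqrt_pos.2 hn'
  have hss : √(n : ℝ) ^ 2 = n := Real.sq_sqrt hn'.le
  have hB0 : 0 ≤ B := (abs_nonneg _).trans (hb 0)
  set θ : ℕ → ℝ := fun t => (√(n : ℝ))⁻¹ * X t with hθdef
  have hθ : ∀ t, |θ t| ≤ (√(n : ℝ))⁻¹ * B := fun t => by
    rw [hθdef]
    simp only [abs_mul, abs_of_pos (inv_pos.2 hs)]
    exact mul_le_mul_of_nonneg_left (hb t) (inv_pos.2 hs).le
  have hθ1 : ∀ t, |θ t| ≤ 1 := fun t => (hθ t).trans <| by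
    rw [inv_mul_le_iff₀ hs]; linarith
  have hθsq : ∀ t, θ t ^ 2 = (n : ℝ)⁻¹ * X t ^ 2 := fun t => by
    rw [hθdef]; simp only [mul_pow, inv_pow, hss]
  set V : ℝ := ∑ t ∈ Finset.range n, θ t ^ 2 with hV
  have hV0 : 0 ≤ V := Finset.sum_nonneg fun t _ => sq_nonneg _
  have hVB : V ≤ B ^ 2 := by
    calc V ≤ ∑ _t ∈ Finset.range n, (n : ℝ)⁻¹ * B ^ 2 := by
          refine Finset.sum_le_sum fun t _ => ?_
          rw [hθsq, ← sq_abs (X t)]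
          gcongr
          exact hb t
      _ = B ^ 2 := by simp; field_simp
  set T : ℂ := ∏ t ∈ Finset.range n, (1 + θ t * Complex.I) with hT
  have hTn : ‖T‖ ≤ Real.exp (B ^ 2 / 2) := by
    rw [hT, norm_prod]
    calc ∏ t ∈ Finset.range n, ‖(1 + θ t * Complex.I : ℂ)‖
        ≤ ∏ t ∈ Finset.range n, Real.exp (θ t ^ 2 / 2) :=
          Finset.prod_le_prod (fun _ _ => norm_nonneg _) fun t _ => norm_one_add_mul_I_le _
      _ = Real.exp (V / 2) := by rw [← Real.exp_sum, ← Finset.sum_div]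
      _ ≤ Real.exp (B ^ 2 / 2) := Real.exp_le_exp.2 (by linarith)
  -- The comparison passes through `T exp(-V/2)`. Here the factors are exchanged, at a cost of `n`
  -- cubic errors `3 (B/√n)³`; `h2` then replaces the random `V` by `σ2`.
  have h1 : ‖Complex.exp (((√(n : ℝ))⁻¹ * ∑ t ∈ Finset.range n, X t : ℝ) * Complex.I)
      - T * Real.exp (-(V / 2))‖ ≤ 3 * B ^ 3 * (√(n : ℝ))⁻¹ := by
    have e1 : Complex.exp (((√(n : ℝ))⁻¹ * ∑ t ∈ Finset.range n, X t : ℝ) * Complex.I) =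
        ∏ t ∈ Finset.range n, Complex.exp (θ t * Complex.I) := by
      rw [← Complex.exp_sum, ← Finset.sum_mul, Finset.mul_sum]
      simp only [hθdef, Complex.ofReal_sum]
    have e2 : T * Real.exp (-(V / 2)) =
        ∏ t ∈ Finset.range n, ((1 + θ t * Complex.I) * Real.exp (-θ t ^ 2 / 2)) := by
      rw [Finset.prod_mul_distrib, ← hT, ← Complex.ofReal_prod, ← Real.exp_sum, ← Finset.sum_div,
        Finset.sum_neg_distrib, neg_div]
    rw [e1, e2]
    refine (norm_prod_sub_prod_le_sum _ _ _ (fun t => ?_) fun t => ?_).trans ?_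
    · rw [Complex.norm_exp_ofReal_mul_I]
    · rw [norm_mul, Complex.norm_real, Real.norm_eq_abs, Real.abs_exp]
      calc _ ≤ Real.exp (θ t ^ 2 / 2) * Real.exp (-θ t ^ 2 / 2) :=
            mul_le_mul_of_nonneg_right (norm_one_add_mul_I_le _) (Real.exp_pos _).le
        _ = 1 := by rw [← Real.exp_add, neg_div, add_neg_cancel, Real.exp_zero]
    · calc _ ≤ ∑ t ∈ Finset.range n, 3 * ((√(n : ℝ))⁻¹ * B) ^ 3 :=
            Finset.sum_le_sum fun t _ => (norm_exp_mul_I_sub_le (hθ1 t)).trans <| by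
              gcongr
              exact hθ t
        _ = 3 * B ^ 3 * (√(n : ℝ))⁻¹ := by
          rw [Finset.sum_const, Finset.card_range, nsmul_eq_mul]
          nth_rewrite 1 [← hss]
          field_simp
  have h2 : ‖T * Real.exp (-(V / 2)) - T * Real.exp (-(σ2 / 2))‖ ≤
      Real.exp (B ^ 2 / 2) / 2 * |(n : ℝ)⁻¹ * ∑ t ∈ Finset.range n, (X t ^ 2 - σ2)| := by
    have e : (n : ℝ)⁻¹ * ∑ t ∈ Finset.range n, (X t ^ 2 - σ2) = V - σ2 := by
      rw [Finset.sum_sub_distrib, mul_sub, Finset.mul_sum, hV]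
      simp_rw [hθsq]
      simp [hn'.ne']
    rw [e, ← mul_sub, norm_mul, ← Complex.ofReal_sub, Complex.norm_real, Real.norm_eq_abs]
    have h := abs_exp_neg_sub_exp_neg_le (by positivity : 0 ≤ V / 2) (by positivity : 0 ≤ σ2 / 2)
    rw [← sub_div, abs_div, abs_two] at h
    calc _ ≤ Real.exp (B ^ 2 / 2) * (|V - σ2| / 2) :=
          mul_le_mul hTn h (abs_nonneg _) (Real.exp_pos _).le
      _ = _ := by ring
  calc _ ≤ _ := norm_sub_le_norm_sub_add_norm_sub _ (T * Real.exp (-(V / 2))) _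
    _ ≤ _ := add_le_add h1 h2

/-- `hprod` carries the martingale property and `hV` the law of large numbers for the squares; the
pointwise bound is then integrated. -/
lemma tendsto_integral_exp_sum {X : ℕ → Ω → ℝ} {B σ2 : ℝ} (hσ : 0 ≤ σ2)
    (hm : ∀ t, Measurable (X t)) (hb : ∀ t ω, |X t ω| ≤ B)
    (hprod : ∀ (c : ℝ) (n : ℕ),
      ∫ ω, ∏ t ∈ Finset.range n, (1 + ((c * X t ω : ℝ) : ℂ) * Complex.I) ∂P = 1)
    (hV : Tendsto (fun n : ℕ => ∫ ω, |(n : ℝ)⁻¹ * ∑ t ∈ Finset.range n, (X t ω ^ 2 - σ2)| ∂P)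
      atTop (nhds 0)) :
    Tendsto (fun n : ℕ => ∫ ω, Complex.exp
      (((√(n : ℝ))⁻¹ * ∑ t ∈ Finset.range n, X t ω : ℝ) * Complex.I) ∂P) atTop
      (nhds (Real.exp (-(σ2 / 2)) : ℂ)) := by
  rw [tendsto_iff_norm_sub_tendsto_zero]
  have hsqrt : Tendsto (fun n : ℕ => √(n : ℝ)) atTop atTop :=
    Real.tendsto_sqrt_atTop.comp tendsto_natCast_atTop_atTop
  have hlim : Tendsto (fun n : ℕ => 3 * B ^ 3 * (√(n : ℝ))⁻¹ + Real.exp (B ^ 2 / 2) / 2 *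
      ∫ ω, |(n : ℝ)⁻¹ * ∑ t ∈ Finset.range n, (X t ω ^ 2 - σ2)| ∂P) atTop (nhds 0) := by
    simpa using ((tendsto_inv_atTop_zero.comp hsqrt).const_mul (3 * B ^ 3)).add
      (hV.const_mul (Real.exp (B ^ 2 / 2) / 2))
  refine tendsto_of_tendsto_of_tendsto_of_le_of_le' tendsto_const_nhds hlim
    (.of_forall fun n => norm_nonneg _) ?_
  filter_upwards [eventually_gt_atTop 0, hsqrt.eventually_ge_atTop B] with n hn hnB
  set c : ℝ := (√(n : ℝ))⁻¹
  have hiE : Integrable (fun ω => Complex.exp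
      ((c * ∑ t ∈ Finset.range n, X t ω : ℝ) * Complex.I)) P :=
    Integrable.of_bound (Measurable.aestronglyMeasurable (by fun_prop)) 1
      (ae_of_all _ fun ω => (Complex.norm_exp_ofReal_mul_I _).le)
  have hiT : Integrable (fun ω => (∏ t ∈ Finset.range n, (1 + ((c * X t ω : ℝ) : ℂ) * Complex.I))
      * (Real.exp (-(σ2 / 2)) : ℂ)) P := by
    refine Integrable.mul_const ?_ _
    -- A non-integrable function has Bochner integral 0, whereas this integral is 1.
    by_contra h
    have h1 := hprod c n
    rw [integral_undef h] at h1
    exact zero_ne_one h1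
  have hiV : Integrable (fun ω => |(n : ℝ)⁻¹ * ∑ t ∈ Finset.range n, (X t ω ^ 2 - σ2)|) P := by
    refine Integrable.abs (Integrable.const_mul (integrable_finsetSum _ fun t _ => ?_) _)
    refine (integrable_of_abs_le (C := B ^ 2) ((hm t).pow_const 2) fun ω => ?_).sub
      (integrable_const _)
    rw [abs_pow]
    exact pow_le_pow_left₀ (abs_nonneg _) (hb t ω) 2
  have e : ∫ ω, Complex.exp ((c * ∑ t ∈ Finset.range n, X t ω : ℝ) * Complex.I) ∂P
      - (Real.exp (-(σ2 / 2)) : ℂ) =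
      ∫ ω, (Complex.exp ((c * ∑ t ∈ Finset.range n, X t ω : ℝ) * Complex.I)
        - (∏ t ∈ Finset.range n, (1 + ((c * X t ω : ℝ) : ℂ) * Complex.I))
          * (Real.exp (-(σ2 / 2)) : ℂ)) ∂P := by
    rw [integral_sub hiE hiT, integral_mul_const, hprod, one_mul]
  rw [e]
  refine (norm_integral_le_integral_norm _).trans ?_
  calc _ ≤ ∫ ω, (3 * B ^ 3 * c + Real.exp (B ^ 2 / 2) / 2 *
        |(n : ℝ)⁻¹ * ∑ t ∈ Finset.range n, (X t ω ^ 2 - σ2)|) ∂P :=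
        integral_mono (hiE.sub hiT).norm ((integrable_const _).add (hiV.const_mul _)) fun ω =>
          norm_exp_sum_sub_prod_le (fun t => X t ω) B σ2 hσ (fun t => hb t ω) n hn hnB
    _ = _ := by
      rw [integral_add (integrable_const _) (hiV.const_mul _), integral_const,
        probReal_univ, one_smul, integral_const_mul]

end CentralLimit

/-! ### Joint central limit theorem for the lag products. -/

section LagProducts

variable {Ω : Type*} [MeasurableSpace Ω] {P : Measure Ω} [IsProbabilityMeasure P]
  {x : ℕ → Ω → ℝ} {K : ℝ} {m : ℕ}

/-- `x_t ∑_h u_h x_{t+h}`, the sum being over the lags `h = 1, …, m`. -/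
noncomputable def lagCombination (u : Fin m → ℝ) (x : ℕ → ℝ) (t : ℕ) : ℝ :=
  x t * ∑ i, u i * x (t + 1 + i)

lemma measurable_lagCombination (u : Fin m → ℝ) (t : ℕ) :
    Measurable fun y : ℕ → ℝ => lagCombination u y t := by
  unfold lagCombination
  fun_prop

lemma measurable_lagCombination_comp (hm : ∀ i, Measurable (x i)) (u : Fin m → ℝ) (t : ℕ) :
    Measurable fun ω => lagCombination u (fun j => x j ω) t := by
  unfold lagCombination
  fun_prop

lemma abs_sum_mul_le (u : Fin m → ℝ) {y : ℕ → ℝ} (hb : ∀ i, |y i| ≤ K) (t : ℕ) :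
    |∑ i, u i * y (t + 1 + i)| ≤ (∑ i, |u i|) * K := by
  refine (Finset.abs_sum_le_sum_abs _ _).trans ?_
  rw [Finset.sum_mul]
  refine Finset.sum_le_sum fun i _ => ?_
  rw [abs_mul]
  exact mul_le_mul_of_nonneg_left (hb _) (abs_nonneg _)

lemma abs_lagCombination_le (u : Fin m → ℝ) {y : ℕ → ℝ} (hb : ∀ i, |y i| ≤ K) (t : ℕ) :
    |lagCombination u y t| ≤ K * ((∑ i, |u i|) * K) := by
  rw [lagCombination, abs_mul]
  exact mul_le_mul (hb t) (abs_sum_mul_le u hb t) (abs_nonneg _) ((abs_nonneg _).trans (hb t))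

/-- The earliest observation `x_k` occurs only in the factor `t = k`, and linearly. Being centred
and independent of the future, it contributes nothing, so that factor can be dropped; the induction
moves the starting time `k`. -/
lemma integral_prod_one_add_lagCombination (hm : ∀ i, Measurable (x i))
    (hb : ∀ i ω, |x i ω| ≤ K) (hi : iIndepFun x P) (h0 : ∀ i, ∫ ω, x i ω ∂P = 0)
    (u : Fin m → ℝ) (c : ℝ) (n k : ℕ) :
    ∫ ω, ∏ t ∈ Finset.range n,
      (1 + ((c * lagCombination u (fun j => x j ω) (k + t) : ℝ) : ℂ) * Complex.I) ∂P = 1 := by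
  induction n generalizing k with
  | zero => simp
  | succ n ih =>
    set R : (ℕ → ℝ) → ℂ := fun y => ∏ t ∈ Finset.range n,
      (1 + ((c * lagCombination u y t : ℝ) : ℂ) * Complex.I) with hR
    -- `W` is the coefficient of `x_k`. Both `R` and `W` are functions of the future re-indexed from
    -- 0.
    set W : (ℕ → ℝ) → ℂ := fun y => R y * ((c * ∑ i : Fin m, u i * y i : ℝ) * Complex.I) with hW
    have hRm : Measurable R := Finset.measurable_prod _ fun t _ => by
      have := measurable_lagCombination u t
      fun_prop
    have hWm : Measurable W := hRm.mul (by fun_prop)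
    have hmf : Measurable fun ω (j : ℕ) => x (k + 1 + j) ω :=
      measurable_pi_lambda _ fun j => hm _
    have hRe : ∀ ω, R (fun j => x (k + 1 + j) ω) = ∏ t ∈ Finset.range n,
        (1 + ((c * lagCombination u (fun j => x j ω) (k + 1 + t) : ℝ) : ℂ) * Complex.I) := by
      intro ω
      simp only [hR, lagCombination, add_assoc]
    have hsplit : ∀ ω, ∏ t ∈ Finset.range (n + 1),
        (1 + ((c * lagCombination u (fun j => x j ω) (k + t) : ℝ) : ℂ) * Complex.I) =
        R (fun j => x (k + 1 + j) ω) + (x k ω : ℂ) * W (fun j => x (k + 1 + j) ω) := by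
      intro ω
      have hk : lagCombination u (fun j => x j ω) k = x k ω * ∑ i : Fin m, u i * x (k + 1 + i) ω :=
        rfl
      have hshift : ∏ t ∈ Finset.range n,
          (1 + ((c * lagCombination u (fun j => x j ω) (k + (t + 1)) : ℝ) : ℂ) * Complex.I) =
          R (fun j => x (k + 1 + j) ω) := by
        rw [hRe]
        exact Finset.prod_congr rfl fun t _ => by rw [show k + (t + 1) = k + 1 + t by ring]
      rw [Finset.prod_range_succ', hshift, add_zero, hk]
      simp only [hW]
      generalize R (fun j => x (k + 1 + j) ω) = r
      push_cast
      ring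
    have hind : IndepFun (fun ω => (x k ω : ℂ)) (fun ω => W (fun j => x (k + 1 + j) ω)) P :=
      (indepFun_now_future hm hi k).comp Complex.measurable_ofReal hWm
    have hx0 : ∫ ω, (x k ω : ℂ) ∂P = 0 := by
      rw [integral_complex_ofReal, h0, Complex.ofReal_zero]
    have hxi : Integrable (fun ω => (x k ω : ℂ)) P := (integrable_of_abs_le (hm k) (hb k)).ofReal
    have hRi : Integrable (fun ω => R (fun j => x (k + 1 + j) ω)) P := by
      by_contra h
      have h1 := ih (k + 1)
      simp only [← hRe] at h1
      rw [integral_undef h] at h1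
      exact zero_ne_one h1
    have hWi : Integrable (fun ω => W (fun j => x (k + 1 + j) ω)) P := by
      refine hRi.mul_bdd (c := |c| * ((∑ i, |u i|) * K)) ?_ (ae_of_all _ fun ω => ?_)
      · exact Measurable.aestronglyMeasurable (by fun_prop)
      · rw [norm_mul, Complex.norm_I, mul_one, Complex.norm_real, Real.norm_eq_abs, abs_mul]
        exact mul_le_mul_of_nonneg_left (abs_sum_mul_le u (fun j => hb j ω) k) (abs_nonneg _)
    have hxW : Integrable (fun ω => (x k ω : ℂ) * W (fun j => x (k + 1 + j) ω)) P :=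
      hind.integrable_mul hxi hWi
    simp only [hsplit]
    rw [integral_add hRi hxW, hind.integral_fun_mul_eq_mul_integral hxi.aestronglyMeasurable hWi.aestronglyMeasurable,
      hx0, zero_mul, add_zero]
    simp only [hRe]
    exact ih (k + 1)

lemma integral_mul_eq_ite {Ω : Type*} [MeasurableSpace Ω] {P : Measure Ω} {x : ℕ → Ω → ℝ}
    (hm : ∀ i, Measurable (x i)) (hi : iIndepFun x P)
    (h0 : ∀ i, ∫ ω, x i ω ∂P = 0) (h1 : ∀ i, ∫ ω, x i ω ^ 2 ∂P = 1) (i j : ℕ) :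
    ∫ ω, x i ω * x j ω ∂P = if i = j then 1 else 0 := by
  split_ifs with h
  · subst h
    simpa [sq] using h1 i
  · rw [(hi.indepFun h).integral_fun_mul_eq_mul_integral (hm i).aestronglyMeasurable
      (hm j).aestronglyMeasurable, h0, zero_mul]

/-- `x_t²` is independent of the later observations, which are orthonormal. -/
lemma integral_sq_lagCombination (hm : ∀ i, Measurable (x i)) (hb : ∀ i ω, |x i ω| ≤ K)
    (hi : iIndepFun x P) (h0 : ∀ i, ∫ ω, x i ω ∂P = 0) (h1 : ∀ i, ∫ ω, x i ω ^ 2 ∂P = 1)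
    (u : Fin m → ℝ) (t : ℕ) :
    ∫ ω, lagCombination u (fun j => x j ω) t ^ 2 ∂P = ∑ i, u i ^ 2 := by
  have hind : IndepFun (fun ω => x t ω ^ 2)
      (fun ω => (∑ i : Fin m, u i * x (t + 1 + i) ω) ^ 2) P :=
    (indepFun_now_future hm hi t).comp (φ := fun y : ℝ => y ^ 2)
      (ψ := fun y : ℕ → ℝ => (∑ i : Fin m, u i * y i) ^ 2) (by fun_prop) (by fun_prop)
  have hxx : ∀ i j, Integrable (fun ω => x i ω * x j ω) P := fun i j =>
    integrable_of_abs_le (C := K * K) ((hm i).mul (hm j)) fun ω => by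
      rw [abs_mul]
      exact mul_le_mul (hb i ω) (hb j ω) (abs_nonneg _) ((abs_nonneg _).trans (hb i ω))
  simp only [lagCombination, mul_pow]
  rw [hind.integral_fun_mul_eq_mul_integral (Measurable.aestronglyMeasurable (by fun_prop))
    (Measurable.aestronglyMeasurable (by fun_prop)), h1, one_mul]
  have e : ∀ ω, (∑ i : Fin m, u i * x (t + 1 + i) ω) ^ 2 = ∑ i : Fin m, ∑ j : Fin m,
      u i * u j * (x (t + 1 + i) ω * x (t + 1 + j) ω) := fun ω => by
    rw [sq, Finset.sum_mul_sum]
    refine Finset.sum_congr rfl fun i _ => Finset.sum_congr rfl fun j _ => by ring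
  simp only [e]
  rw [integral_finsetSum _ fun i _ => integrable_finsetSum _ fun j _ => (hxx _ _).const_mul _]
  refine Finset.sum_congr rfl fun i _ => ?_
  rw [integral_finsetSum _ fun j _ => (hxx _ _).const_mul _]
  simp only [integral_const_mul, integral_mul_eq_ite hm hi h0 h1]
  simp [Fin.val_inj, sq]

/-- The combination at `s` involves only times up to `s + m < t`, so it is independent of the one at
`t`. -/
lemma integral_sq_lagCombination_sub_mul_eq_zero (hm : ∀ i, Measurable (x i))
    (hb : ∀ i ω, |x i ω| ≤ K) (hi : iIndepFun x P) (h0 : ∀ i, ∫ ω, x i ω ∂P = 0)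
    (h1 : ∀ i, ∫ ω, x i ω ^ 2 ∂P = 1) (u : Fin m → ℝ) {s t : ℕ} (hst : s + m < t) :
    ∫ ω, (lagCombination u (fun j => x j ω) s ^ 2 - ∑ i, u i ^ 2) *
      (lagCombination u (fun j => x j ω) t ^ 2 - ∑ i, u i ^ 2) ∂P = 0 := by
  have hml : ∀ r, Measurable fun y : ℕ → ℝ => lagCombination u y r ^ 2 - ∑ i, u i ^ 2 := fun r =>
    ((measurable_lagCombination u r).pow_const 2).sub_const _
  have hind := (indepFun_past_future hm hi t).comp (hml s) (hml 0)
  -- Zero padding from time `t` on does not affect the combination at `s`.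
  have e1 : ∀ ω, lagCombination u (fun j => if j < t then x j ω else 0) s =
      lagCombination u (fun j => x j ω) s := fun ω => by
    simp only [lagCombination]
    rw [if_pos (by omega)]
    congr 1
    refine Finset.sum_congr rfl fun i _ => ?_
    rw [if_pos (by omega)]
  have e2 : ∀ ω, lagCombination u (fun j => x (t + j) ω) 0 =
      lagCombination u (fun j => x j ω) t := fun ω => by
    simp only [lagCombination, add_zero, zero_add, add_assoc]
  simp only [Function.comp_def, e1, e2] at hind
  have hmr : ∀ r, Measurable fun ω => lagCombination u (fun j => x j ω) r ^ 2 - ∑ i, u i ^ 2 :=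
    fun r => ((measurable_lagCombination_comp hm u r).pow_const 2).sub_const _
  rw [hind.integral_fun_mul_eq_mul_integral (hmr s).aestronglyMeasurable
    (hmr t).aestronglyMeasurable, integral_sub _ (integrable_const _),
    integral_sq_lagCombination hm hb hi h0 h1]
  · simp
  · refine integrable_of_abs_le (C := (K * ((∑ i, |u i|) * K)) ^ 2)
      ((measurable_lagCombination_comp hm u s).pow_const 2) fun ω => ?_
    rw [abs_pow]
    exact pow_le_pow_left₀ (abs_nonneg _) (abs_lagCombination_le u (fun j => hb j ω) s) 2

/-- The vector of the normalised sums `n^{-1/2} ∑_{t<n} x_t x_{t+h}`, `h = 1, …, m`. -/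
noncomputable def lagProductVec (m : ℕ) (x : ℕ → ℝ) (n : ℕ) : EuclideanSpace ℝ (Fin m) :=
  WithLp.toLp 2 fun i : Fin m => (√(n : ℝ))⁻¹ * ∑ t ∈ Finset.range n, x t * x (t + 1 + i)

lemma measurable_lagProductVec (hm : ∀ i, Measurable (x i)) (n : ℕ) :
    Measurable fun ω => lagProductVec m (fun j => x j ω) n := by
  unfold lagProductVec
  fun_prop

lemma inner_lagProductVec (y : ℕ → ℝ) (n : ℕ) (u : EuclideanSpace ℝ (Fin m)) :
    inner ℝ (lagProductVec m y n) u =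
      (√(n : ℝ))⁻¹ * ∑ t ∈ Finset.range n, lagCombination u.ofLp y t := by
  simp only [lagProductVec, lagCombination, PiLp.inner_apply, RCLike.inner_apply, conj_trivial,
    Finset.mul_sum]
  rw [Finset.sum_comm]
  refine Finset.sum_congr rfl fun t _ => Finset.sum_congr rfl fun i _ => by ring

/-- The central limit theorem for the vector of lag products. -/
theorem tendstoInDistribution_lagProductVec (hm : ∀ i, Measurable (x i))
    (hb : ∀ i ω, |x i ω| ≤ K) (hi : iIndepFun x P) (h0 : ∀ i, ∫ ω, x i ω ∂P = 0)
    (h1 : ∀ i, ∫ ω, x i ω ^ 2 ∂P = 1) :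
    TendstoInDistribution (fun (n : ℕ) (ω : Ω) => lagProductVec m (fun t => x t ω) n) atTop
      (id : EuclideanSpace ℝ (Fin m) → EuclideanSpace ℝ (Fin m)) (fun _ => P)
      (multivariateGaussian 0 (1 : Matrix (Fin m) (Fin m) ℝ)) where
  forall_aemeasurable n := (measurable_lagProductVec hm n).aemeasurable
  aemeasurable_limit := aemeasurable_id
  tendsto := by
    refine ProbabilityMeasure.tendsto_iff_tendsto_charFun.2 fun u => ?_
    simp only [ProbabilityMeasure.coe_mk, Measure.map_id, multivariateGaussian_zero_one]
    rw [charFun_stdGaussian]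
    have hb' : ∀ t ω, |lagCombination u.ofLp (fun j => x j ω) t| ≤ K * ((∑ i, |u i|) * K) :=
      fun t ω => abs_lagCombination_le _ (fun j => hb j ω) t
    have hb2 : ∀ t ω, |lagCombination u.ofLp (fun j => x j ω) t ^ 2 - ∑ i, u i ^ 2| ≤
        (K * ((∑ i, |u i|) * K)) ^ 2 + ∑ i, u i ^ 2 := fun t ω => by
      refine (abs_sub _ _).trans ?_
      rw [abs_pow, abs_of_nonneg (Finset.sum_nonneg fun i _ => sq_nonneg (u i))]
      gcongr
      exact hb' t ω
    have h := tendsto_integral_exp_sum (P := P) (σ2 := ∑ i, u i ^ 2)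
      (X := fun t ω => lagCombination u.ofLp (fun j => x j ω) t)
      (Finset.sum_nonneg fun i _ => sq_nonneg (u i))
      (measurable_lagCombination_comp hm u.ofLp) hb'
      (fun c n => by
        simpa using integral_prod_one_add_lagCombination hm hb hi h0 u.ofLp c n 0)
      (tendsto_integral_abs_average
        (fun t => ((measurable_lagCombination_comp hm u.ofLp t).pow_const 2).sub_const _) hb2 m
        fun s t hst => integral_sq_lagCombination_sub_mul_eq_zero hm hb hi h0 h1 u.ofLp hst)
    convert! h using 1
    · funext n
      rw [charFun_apply, integral_map (measurable_lagProductVec hm n).aemeasurable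
        (Measurable.aestronglyMeasurable (by fun_prop))]
      simp only [inner_lagProductVec]
    · rw [← EuclideanSpace.real_norm_sq_eq, ← neg_div]
      push_cast
      rfl

end LagProducts

/-! ### Algebra of sample means and autocovariances. -/

section SampleMoments

/-- The statistics read times `1, …, n` while the noise starts at 0; `t - 1` is never truncated
here, since `t ≥ 1`. -/
lemma sampleMean_shift (y : ℕ → ℝ) (n : ℕ) :
    sampleMean (fun t => y (t - 1)) n = (n : ℝ)⁻¹ * ∑ t ∈ Finset.range n, y t := by
  rw [sampleMean, one_div, ← Finset.Ico_add_one_right_eq_Icc, Finset.sum_Ico_eq_sum_range]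
  simp

lemma sampleAutocov_shift (y : ℕ → ℝ) (n h : ℕ) :
    sampleAutocov (fun t => y (t - 1)) n h = (n : ℝ)⁻¹ * ∑ t ∈ Finset.range (n - h),
      (y (t + h) - sampleMean (fun t => y (t - 1)) n) *
        (y t - sampleMean (fun t => y (t - 1)) n) := by
  rw [sampleAutocov, one_div, ← Finset.Ico_add_one_right_eq_Icc, Finset.sum_Ico_eq_sum_range,
    show n + 1 - (1 + h) = n - h by omega]
  congr 1
  refine Finset.sum_congr rfl fun t _ => ?_
  rw [show 1 + h + t - 1 = t + h by omega, show 1 + h + t - h - 1 = t by omega]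

lemma abs_sum_le_card_mul {ι : Type*} (s : Finset ι) {f : ι → ℝ} {C : ℝ} (hf : ∀ i, |f i| ≤ C) :
    |∑ i ∈ s, f i| ≤ s.card * C := by
  refine (Finset.abs_sum_le_sum_abs _ _).trans ((Finset.sum_le_sum fun i _ => hf i).trans ?_)
  simp

/-- Up to the squared mean and a bounded error, the sample autocovariance is the lag product sum. -/
lemma abs_mul_sampleAutocov_sub_le {y : ℕ → ℝ} {K : ℝ} (hb : ∀ i, |y i| ≤ K) (n h : ℕ) :
    |n * sampleAutocov (fun t => y (t - 1)) n h - ∑ t ∈ Finset.range n, y t * y (t + h)| ≤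
      n * sampleMean (fun t => y (t - 1)) n ^ 2 + 6 * h * K ^ 2 := by
  have hK : 0 ≤ K := (abs_nonneg _).trans (hb 0)
  rcases Nat.eq_zero_or_pos n with rfl | hn
  · simp
    positivity
  have hn' : (0 : ℝ) < n := by exact_mod_cast hn
  rw [sampleAutocov_shift, mul_inv_cancel_left₀ hn'.ne']
  set μ := sampleMean (fun t => y (t - 1)) n with hμ
  have hS : ∑ t ∈ Finset.range n, y t = n * μ := by
    rw [hμ, sampleMean_shift, mul_inv_cancel_left₀ hn'.ne']
  have hμK : |μ| ≤ K := by
    have h := abs_sum_le_card_mul (Finset.range n) hb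
    rw [hS, Finset.card_range, abs_mul, abs_of_pos hn'] at h
    exact le_of_mul_le_mul_left h hn'
  set f : ℕ → ℝ := fun t => (y (t + h) - μ) * (y t - μ) with hf
  have hfb : ∀ t, |f t| ≤ 4 * K ^ 2 := fun t => by
    have h1 : ∀ s, |y s - μ| ≤ 2 * K := fun s => (abs_sub _ _).trans (by linarith [hb s])
    rw [hf]
    simp only [abs_mul]
    refine (mul_le_mul (h1 _) (h1 _) (abs_nonneg _) (by linarith)).trans_eq (by ring)
  -- Extending the sum to all `t < n` adds at most `h` terms, also when `n < h`. This gives `4hK²`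
  -- of the final `6hK²`; the shift `δ`, at most `2hK`, gives the rest.
  have htail : |∑ t ∈ Finset.Ico (n - h) n, f t| ≤ h * (4 * K ^ 2) := by
    refine (abs_sum_le_card_mul _ hfb).trans ?_
    have : ((Finset.Ico (n - h) n).card : ℝ) ≤ h := by
      rw [Nat.card_Ico]
      exact_mod_cast (by omega : n - (n - h) ≤ h)
    gcongr
  have hsplit := Finset.sum_range_add_sum_Ico f (Nat.sub_le n h)
  set δ := ∑ t ∈ Finset.range n, y (t + h) - ∑ t ∈ Finset.range n, y t with hδ
  have hδb : |δ| ≤ h * K + h * K := by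
    have h1 := Finset.sum_range_add y n h
    have h2 := Finset.sum_range_add y h n
    rw [add_comm h n, h1] at h2
    simp only [add_comm h] at h2
    have h3 : δ = ∑ t ∈ Finset.range h, y (n + t) - ∑ t ∈ Finset.range h, y t := by
      rw [hδ]; linarith
    rw [h3]
    refine (abs_sub _ _).trans (add_le_add ?_ ?_)
    · simpa using abs_sum_le_card_mul (Finset.range h) fun t => hb (n + t)
    · simpa using abs_sum_le_card_mul (Finset.range h) hb
  have hfull : ∑ t ∈ Finset.range n, f t =
      ∑ t ∈ Finset.range n, y t * y (t + h) - n * μ ^ 2 - μ * δ := by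
    have e : ∀ t, f t = y t * y (t + h) - μ * y (t + h) - μ * y t + μ ^ 2 := fun t => by
      rw [hf]; ring
    simp only [e, Finset.sum_add_distrib, Finset.sum_sub_distrib, ← Finset.mul_sum,
      Finset.sum_const, Finset.card_range, nsmul_eq_mul]
    rw [show ∑ t ∈ Finset.range n, y (t + h) = δ + ∑ t ∈ Finset.range n, y t by rw [hδ]; ring, hS]
    ring
  have e : ∑ t ∈ Finset.range (n - h), f t - ∑ t ∈ Finset.range n, y t * y (t + h) =
      -(n * μ ^ 2) + -(μ * δ) + -(∑ t ∈ Finset.Ico (n - h) n, f t) := by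
    linarith
  rw [e]
  refine (abs_add_three _ _ _).trans ?_
  rw [abs_neg, abs_neg, abs_neg, abs_of_nonneg (by positivity : 0 ≤ n * μ ^ 2), abs_mul]
  have h1 : |μ| * |δ| ≤ K * (h * K + h * K) := mul_le_mul hμK hδb (abs_nonneg _) hK
  nlinarith

lemma sampleMean_affine {a y : ℕ → ℝ} {b c : ℝ} (ha : ∀ t, 1 ≤ t → a t = b + c * y t) {n : ℕ}
    (hn : n ≠ 0) : sampleMean a n = b + c * sampleMean y n := by
  have hn' : (n : ℝ) ≠ 0 := Nat.cast_ne_zero.2 hn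
  have hsum : ∑ t ∈ Finset.Icc 1 n, a t = ∑ t ∈ Finset.Icc 1 n, (b + c * y t) :=
    Finset.sum_congr rfl fun t ht => ha t (Finset.mem_Icc.1 ht).1
  rw [sampleMean, sampleMean, hsum, Finset.sum_add_distrib, ← Finset.mul_sum]
  simp
  field_simp

lemma sampleAutocov_affine {a y : ℕ → ℝ} {b c : ℝ} (ha : ∀ t, 1 ≤ t → a t = b + c * y t)
    (n h : ℕ) : sampleAutocov a n h = c ^ 2 * sampleAutocov y n h := by
  rcases eq_or_ne n 0 with rfl | hn
  · simp [sampleAutocov]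
  rw [sampleAutocov, sampleAutocov, sampleMean_affine ha hn, mul_left_comm]
  congr 1
  rw [Finset.mul_sum]
  refine Finset.sum_congr rfl fun t ht => ?_
  have ht := (Finset.mem_Icc.1 ht).1
  rw [ha t (by omega), ha (t - h) (by omega)]
  ring

/-- Sample autocorrelations are invariant under affine transformations of the observations. -/
lemma autocorrVec_affine {a y : ℕ → ℝ} {b c : ℝ} (hc : c ≠ 0)
    (ha : ∀ t, 1 ≤ t → a t = b + c * y t) (m n : ℕ) : autocorrVec m a n = autocorrVec m y n := by
  simp only [autocorrVec, sampleAutocov_affine ha, mul_div_mul_left _ _ (pow_ne_zero 2 hc)]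

lemma portmanteauStat_eq_norm_sq (m : ℕ) (y : ℕ → ℝ) (n : ℕ) :
    portmanteauStat m y n = ‖√(n : ℝ) • autocorrVec m y n‖ ^ 2 := by
  rw [norm_smul, mul_pow, EuclideanSpace.real_norm_sq_eq, Real.norm_eq_abs, sq_abs,
    Real.sq_sqrt n.cast_nonneg, portmanteauStat]
  simp [dotProduct, sq]

end SampleMoments

/-! ### Convergence in probability and Slutsky's theorem. -/

section Convergence

variable {Ω : Type*} [MeasurableSpace Ω] {P : Measure Ω} [IsProbabilityMeasure P]

/-- Markov's inequality for the dominating variable. -/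
lemma tendstoInMeasure_const_of_integral {E : Type*} [SeminormedAddCommGroup E] {f : ℕ → Ω → E}
    {c : E} {g : ℕ → Ω → ℝ} (hg : ∀ n, Integrable (g n) P)
    (hfg : ∀ᶠ n in atTop, ∀ ω, ‖f n ω - c‖ ≤ g n ω)
    (hlim : Tendsto (fun n => ∫ ω, g n ω ∂P) atTop (nhds 0)) :
    TendstoInMeasure P f atTop (fun _ => c) := by
  rw [tendstoInMeasure_iff_measureReal_norm]
  intro ε hε
  refine tendsto_of_tendsto_of_tendsto_of_le_of_le' tendsto_const_nhds
    (by simpa using hlim.const_mul ε⁻¹) (.of_forall fun n => measureReal_nonneg) ?_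
  filter_upwards [hfg] with n hn
  rw [← div_eq_inv_mul, le_div_iff₀ hε, mul_comm]
  refine le_trans ?_ (mul_meas_ge_le_integral_of_nonneg
    (ae_of_all _ fun ω => (norm_nonneg _).trans (hn ω)) (hg n) ε)
  exact mul_le_mul_of_nonneg_left (measureReal_mono fun ω hω => le_trans hω (hn ω)) hε.le

lemma tendstoInMeasure_inv_one {f : ℕ → Ω → ℝ} (hf : TendstoInMeasure P f atTop fun _ => 1) :
    TendstoInMeasure P (fun n ω => (f n ω)⁻¹) atTop fun _ => 1 := by
  rw [tendstoInMeasure_iff_measureReal_norm] at hf ⊢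
  intro ε hε
  -- Within `1/2` of 1 the value exceeds `1/2`, so inversion at most doubles the distance to 1.
  have hδ : 0 < min (1 / 2) (ε / 2) := by positivity
  refine tendsto_of_tendsto_of_tendsto_of_le_of_le tendsto_const_nhds (hf _ hδ)
    (fun n => measureReal_nonneg) fun n => measureReal_mono fun ω hω => ?_
  simp only [Set.mem_ofPred_eq, Real.norm_eq_abs] at hω ⊢
  by_contra! h
  obtain ⟨h1, h2⟩ := lt_min_iff.1 h
  have h3 : 1 / 2 < f n ω := by linarith [(abs_lt.1 h1).1]
  have e : (f n ω)⁻¹ - 1 = -(f n ω - 1) / f n ω := by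
    field_simp
    ring
  rw [e, abs_div, abs_neg, abs_of_pos (by linarith : 0 < f n ω), le_div_iff₀ (by linarith)] at hω
  nlinarith

variable {x : ℕ → Ω → ℝ} {K : ℝ} {m : ℕ}

lemma measurable_sampleMean {y : ℕ → Ω → ℝ} (hm : ∀ i, Measurable (y i)) (n : ℕ) :
    Measurable fun ω => sampleMean (fun t => y t ω) n := by
  unfold sampleMean
  fun_prop

lemma measurable_sampleAutocov {y : ℕ → Ω → ℝ} (hm : ∀ i, Measurable (y i)) (n h : ℕ) :
    Measurable fun ω => sampleAutocov (fun t => y t ω) n h := by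
  have := measurable_sampleMean hm n
  unfold sampleAutocov
  fun_prop

lemma integrable_sq_sampleMean (hm : ∀ i, Measurable (x i)) (hb : ∀ i ω, |x i ω| ≤ K) (n : ℕ) :
    Integrable (fun ω => sampleMean (fun t => x (t - 1) ω) n ^ 2) P := by
  refine integrable_of_abs_le (C := ((n : ℝ)⁻¹ * (n * K)) ^ 2)
    ((measurable_sampleMean (fun t => hm (t - 1)) n).pow_const 2) fun ω => ?_
  rw [abs_pow, sampleMean_shift (fun t => x t ω), abs_mul, abs_of_nonneg (by positivity : 0 ≤ (n : ℝ)⁻¹)]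
  gcongr
  simpa using abs_sum_le_card_mul (Finset.range n) fun t => hb t ω

/-- Centred independent terms are orthogonal (the case of range 0). This makes `n x̄²` bounded in
`L¹`, hence negligible after division by `√n`. -/
lemma mul_integral_sq_sampleMean_le (hm : ∀ i, Measurable (x i)) (hb : ∀ i ω, |x i ω| ≤ K)
    (hi : iIndepFun x P) (h0 : ∀ i, ∫ ω, x i ω ∂P = 0) (n : ℕ) :
    n * ∫ ω, sampleMean (fun t => x (t - 1) ω) n ^ 2 ∂P ≤ K ^ 2 := by
  rcases Nat.eq_zero_or_pos n with rfl | hn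
  · simpa using sq_nonneg K
  have hn' : (0 : ℝ) < n := by exact_mod_cast hn
  have h := integral_sq_sum_le hm hb 0 (P := P) (fun s t hst => by
    rw [(hi.indepFun (by omega : s ≠ t)).integral_fun_mul_eq_mul_integral
      (hm s).aestronglyMeasurable (hm t).aestronglyMeasurable, h0, zero_mul]) n
  have e : ∀ ω, sampleMean (fun t => x (t - 1) ω) n = (n : ℝ)⁻¹ * ∑ t ∈ Finset.range n, x t ω :=
    fun ω => sampleMean_shift (fun t => x t ω) n
  simp only [e, mul_pow, integral_const_mul]
  calc (n : ℝ) * ((n : ℝ)⁻¹ ^ 2 * ∫ ω, (∑ t ∈ Finset.range n, x t ω) ^ 2 ∂P)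
      = (n : ℝ)⁻¹ * ∫ ω, (∑ t ∈ Finset.range n, x t ω) ^ 2 ∂P := by field_simp
    _ ≤ (n : ℝ)⁻¹ * (n * ((2 * (0 : ℕ) + 1) * K ^ 2)) := by gcongr
    _ = K ^ 2 := by
      rw [inv_mul_cancel_left₀ hn'.ne']
      simp

lemma tendsto_inv_sqrt_natCast : Tendsto (fun n : ℕ => (√(n : ℝ))⁻¹) atTop (nhds 0) :=
  tendsto_inv_atTop_zero.comp (Real.tendsto_sqrt_atTop.comp tendsto_natCast_atTop_atTop)

/-- At lag 0 the boundary error vanishes: `γ̂(0) - 1` is the average of `x_t² - 1` up to `x̄²`, and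
both tend to 0 in `L¹`. -/
lemma tendstoInMeasure_sampleAutocov_zero (hm : ∀ i, Measurable (x i))
    (hb : ∀ i ω, |x i ω| ≤ K) (hi : iIndepFun x P) (h0 : ∀ i, ∫ ω, x i ω ∂P = 0)
    (h1 : ∀ i, ∫ ω, x i ω ^ 2 ∂P = 1) :
    TendstoInMeasure P (fun (n : ℕ) ω => sampleAutocov (fun t => x (t - 1) ω) n 0) atTop
      fun _ => 1 := by
  have hsq : ∀ i ω, |x i ω ^ 2 - 1| ≤ K ^ 2 + 1 := fun i ω => by
    refine (abs_sub _ _).trans ?_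
    rw [abs_pow, abs_one]
    gcongr
    exact hb i ω
  have hmsq : ∀ i, Measurable fun ω => x i ω ^ 2 - 1 := fun i => ((hm i).pow_const 2).sub_const 1
  have hEsq : ∀ i, ∫ ω, (x i ω ^ 2 - 1) ∂P = 0 := fun i => by
    rw [integral_sub (integrable_of_abs_le (C := K ^ 2) ((hm i).pow_const 2) fun ω => by
      rw [abs_pow]; exact pow_le_pow_left₀ (abs_nonneg _) (hb i ω) 2) (integrable_const _), h1]
    simp
  have hLLN := tendsto_integral_abs_average (P := P) hmsq hsq 0 fun s t hst => by
    have hind : IndepFun (fun ω => x s ω ^ 2 - 1) (fun ω => x t ω ^ 2 - 1) P :=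
      (hi.indepFun (by omega : s ≠ t)).comp (φ := fun v => v ^ 2 - 1) (ψ := fun v => v ^ 2 - 1)
        (by fun_prop) (by fun_prop)
    rw [hind.integral_fun_mul_eq_mul_integral (hmsq s).aestronglyMeasurable
      (hmsq t).aestronglyMeasurable, hEsq, zero_mul]
  have hmean : Tendsto (fun n : ℕ => ∫ ω, sampleMean (fun t => x (t - 1) ω) n ^ 2 ∂P) atTop
      (nhds 0) := by
    refine tendsto_of_tendsto_of_tendsto_of_le_of_le' tendsto_const_nhds
      (by simpa using tendsto_inv_atTop_nhds_zero_nat (𝕜 := ℝ) |>.mul_const (K ^ 2))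
      (.of_forall fun n => integral_nonneg fun ω => sq_nonneg _) ?_
    filter_upwards [eventually_gt_atTop 0] with n hn
    have hn' : (0 : ℝ) < n := by exact_mod_cast hn
    rw [← div_eq_inv_mul, le_div_iff₀ hn', mul_comm]
    exact mul_integral_sq_sampleMean_le hm hb hi h0 n
  have hi1 : ∀ n : ℕ, Integrable
      (fun ω => |(n : ℝ)⁻¹ * ∑ t ∈ Finset.range n, (x t ω ^ 2 - 1)|) P := fun n =>
    ((integrable_finsetSum _ fun t _ => integrable_of_abs_le (hmsq t) (hsq t)).const_mul _).abs
  refine tendstoInMeasure_const_of_integral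
    (g := fun n ω => |(n : ℝ)⁻¹ * ∑ t ∈ Finset.range n, (x t ω ^ 2 - 1)| +
      sampleMean (fun t => x (t - 1) ω) n ^ 2)
    (fun n => (hi1 n).add (integrable_sq_sampleMean hm hb n)) ?_ ?_
  · filter_upwards [eventually_gt_atTop 0] with n hn ω
    have hn' : (0 : ℝ) < n := by exact_mod_cast hn
    have h := abs_mul_sampleAutocov_sub_le (fun i => hb i ω) n 0
    simp only [add_zero, Nat.cast_zero, mul_zero, zero_mul, ← sq] at h
    set γ := sampleAutocov (fun t => x (t - 1) ω) n 0
    set S := ∑ t ∈ Finset.range n, x t ω ^ 2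
    have e : γ - 1 = (n : ℝ)⁻¹ * (S - n) + (n : ℝ)⁻¹ * (n * γ - S) := by
      field_simp
      ring
    have e2 : ∑ t ∈ Finset.range n, (x t ω ^ 2 - 1) = S - n := by
      simp [S]
    rw [Real.norm_eq_abs, e, e2]
    refine (abs_add_le _ _).trans (add_le_add_right ?_ _)
    rw [abs_mul, abs_of_pos (inv_pos.2 hn'), inv_mul_le_iff₀ hn']
    exact h
  · simp only [integral_add (hi1 _) (integrable_sq_sampleMean hm hb _)]
    simpa using hLLN.add hmean

/-- The vector `√n (γ̂(1), …, γ̂(m))`. -/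
noncomputable def scaledAutocovVec (m : ℕ) (y : ℕ → ℝ) (n : ℕ) : EuclideanSpace ℝ (Fin m) :=
  WithLp.toLp 2 fun i : Fin m => √(n : ℝ) * sampleAutocov y n (i + 1)

/-- Valid also when `γ̂(0) = 0`, both sides then being 0 by the convention for division by zero. -/
lemma sqrt_smul_autocorrVec (m : ℕ) (y : ℕ → ℝ) (n : ℕ) :
    √(n : ℝ) • autocorrVec m y n = (sampleAutocov y n 0)⁻¹ • scaledAutocovVec m y n := by
  ext i
  simp [autocorrVec, scaledAutocovVec]
  ring

lemma measurable_scaledAutocovVec {y : ℕ → Ω → ℝ} (hm : ∀ i, Measurable (y i)) (n : ℕ) :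
    Measurable fun ω => scaledAutocovVec m (fun t => y t ω) n := by
  have := measurable_sampleAutocov hm n
  unfold scaledAutocovVec
  fun_prop

lemma norm_scaledAutocovVec_sub_lagProductVec_le {y : ℕ → ℝ} (hb : ∀ i, |y i| ≤ K) (n : ℕ) :
    ‖scaledAutocovVec m (fun t => y (t - 1)) n - lagProductVec m y n‖ ≤
      m * ((√(n : ℝ))⁻¹ * (n * sampleMean (fun t => y (t - 1)) n ^ 2 + 6 * m * K ^ 2)) := by
  have hcoord : ∀ i : Fin m,
      |(scaledAutocovVec m (fun t => y (t - 1)) n - lagProductVec m y n) i| ≤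
      (√(n : ℝ))⁻¹ * (n * sampleMean (fun t => y (t - 1)) n ^ 2 + 6 * m * K ^ 2) := by
    intro i
    have h := abs_mul_sampleAutocov_sub_le hb n (i + 1)
    have e : (scaledAutocovVec m (fun t => y (t - 1)) n - lagProductVec m y n) i =
        (√(n : ℝ))⁻¹ * (n * sampleAutocov (fun t => y (t - 1)) n (i + 1) -
          ∑ t ∈ Finset.range n, y t * y (t + (i + 1))) := by
      have hs : √(n : ℝ) = (√(n : ℝ))⁻¹ * n := by
        rw [← div_eq_inv_mul, Real.div_sqrt]
      simp only [scaledAutocovVec, lagProductVec, PiLp.sub_apply]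
      rw [mul_sub, ← mul_assoc, ← hs]
      simp only [add_comm (i : ℕ) 1, add_assoc]
    rw [e, abs_mul, abs_of_nonneg (by positivity : 0 ≤ (√(n : ℝ))⁻¹)]
    refine mul_le_mul_of_nonneg_left (h.trans ?_) (by positivity)
    have him : ((i : ℕ) + 1 : ℝ) ≤ m := by exact_mod_cast i.2
    push_cast
    gcongr
  have hnorm : ∀ v : EuclideanSpace ℝ (Fin m), ‖v‖ ≤ ∑ i, |v i| := fun v => by
    conv_lhs => rw [← (EuclideanSpace.basisFun (Fin m) ℝ).sum_repr v]
    refine (norm_sum_le _ _).trans (Finset.sum_le_sum fun i _ => ?_)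
    simp [norm_smul]
  refine (hnorm _).trans ((Finset.sum_le_sum fun i _ => hcoord i).trans ?_)
  simp

lemma tendstoInMeasure_scaledAutocovVec_sub (hm : ∀ i, Measurable (x i))
    (hb : ∀ i ω, |x i ω| ≤ K) (hi : iIndepFun x P) (h0 : ∀ i, ∫ ω, x i ω ∂P = 0) :
    TendstoInMeasure P ((fun (n : ℕ) ω => scaledAutocovVec m (fun t => x (t - 1) ω) n) -
      fun (n : ℕ) ω => lagProductVec m (fun t => x t ω) n) atTop 0 := by
  have hg : ∀ n : ℕ, Integrable (fun ω => (n : ℝ) * sampleMean (fun t => x (t - 1) ω) n ^ 2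
      + 6 * m * K ^ 2) P := fun n =>
    ((integrable_sq_sampleMean hm hb n).const_mul _).add (integrable_const _)
  refine tendstoInMeasure_const_of_integral (c := 0) (g := fun n ω => m * ((√(n : ℝ))⁻¹ *
      (n * sampleMean (fun t => x (t - 1) ω) n ^ 2 + 6 * m * K ^ 2)))
    (fun n => ((hg n).const_mul _).const_mul _) (.of_forall fun n ω => ?_) ?_
  · rw [sub_zero]
    exact norm_scaledAutocovVec_sub_lagProductVec_le (fun i => hb i ω) n
  · have hlim : Tendsto (fun n : ℕ => m * ((√(n : ℝ))⁻¹ * (K ^ 2 + 6 * m * K ^ 2))) atTop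
        (nhds 0) := by
      simpa using (tendsto_inv_sqrt_natCast.mul_const (K ^ 2 + 6 * m * K ^ 2)).const_mul (m : ℝ)
    refine tendsto_of_tendsto_of_tendsto_of_le_of_le tendsto_const_nhds hlim
      (fun n => integral_nonneg fun ω => by positivity) fun n => ?_
    simp only [integral_const_mul]
    rw [integral_add ((integrable_sq_sampleMean hm hb n).const_mul _) (integrable_const _),
      integral_const_mul, integral_const, probReal_univ, one_smul]
    gcongr
    exact mul_integral_sq_sampleMean_le hm hb hi h0 n

/-- Asymptotic normality of the sample autocorrelations of bounded white noise. -/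
theorem tendstoInDistribution_sqrt_smul_autocorrVec (hm : ∀ i, Measurable (x i))
    (hb : ∀ i ω, |x i ω| ≤ K) (hi : iIndepFun x P) (h0 : ∀ i, ∫ ω, x i ω ∂P = 0)
    (h1 : ∀ i, ∫ ω, x i ω ^ 2 ∂P = 1) :
    TendstoInDistribution
      (fun (n : ℕ) (ω : Ω) => √(n : ℝ) • autocorrVec m (fun t => x (t - 1) ω) n) atTop
      (id : EuclideanSpace ℝ (Fin m) → EuclideanSpace ℝ (Fin m)) (fun _ => P)
      (multivariateGaussian 0 (1 : Matrix (Fin m) (Fin m) ℝ)) := by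
  have hV := tendstoInDistribution_of_tendstoInMeasure_sub _ _
    (tendstoInDistribution_lagProductVec (m := m) hm hb hi h0 h1)
    (tendstoInMeasure_scaledAutocovVec_sub hm hb hi h0)
    fun n => (measurable_scaledAutocovVec (fun i => hm (i - 1)) n).aemeasurable
  -- Division is not continuous at 0, so Slutsky's theorem is applied to the inverse of `γ̂(0)` and
  -- the continuous map `(v, q) ↦ q • v`.
  have hγ := tendstoInMeasure_inv_one (tendstoInMeasure_sampleAutocov_zero hm hb hi h0 h1)
  have h := hV.continuous_comp_prodMk_of_tendstoInMeasure_const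
    (g := fun q : EuclideanSpace ℝ (Fin m) × ℝ => q.2 • q.1) (by fun_prop) hγ
    fun n => (measurable_sampleAutocov (fun i => hm (i - 1)) n 0).inv.aemeasurable
  simpa only [sqrt_smul_autocorrVec, one_smul] using h

end Convergence

/-! ### The squared norm of a standard Gaussian vector. -/

section ChiSquared

lemma map_norm_sq_multivariateGaussian (m : ℕ) :
    (multivariateGaussian 0 (1 : Matrix (Fin m) (Fin m) ℝ)).map (fun v => ‖v‖ ^ 2) =
      chiSquaredMeasure m := by
  rw [multivariateGaussian_zero_one, ← map_pi_eq_stdGaussian,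
    Measure.map_map (by fun_prop) (by fun_prop), chiSquaredMeasure]
  congr 1
  funext z
  simp [EuclideanSpace.real_norm_sq_eq]

end ChiSquared

/-! ### Standardization of Bernoulli variables. -/

section Bernoulli

variable {Ω : Type*} [MeasurableSpace Ω] {P : Measure Ω}

lemma ae_bernoulliMeasure_eq_one_or_zero (p : unitInterval) :
    ∀ᵐ v ∂bernoulliMeasure (1 : ℝ) 0 p, v = 1 ∨ v = 0 := by
  have hs : MeasurableSet {v : ℝ | ¬(v = 1 ∨ v = 0)} :=
    ((measurableSet_singleton (1 : ℝ)).union (measurableSet_singleton 0)).compl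
  rw [ae_iff, bernoulliMeasure_apply_of_notMem_of_notMem p hs (by simp) (by simp)]

/-- A Bernoulli sequence is almost surely an affine image of bounded white noise. -/
lemma exists_standardized_bernoulli {p : unitInterval} (hp0 : 0 < p) (hp1 : p < 1)
    {a : ℕ → Ω → ℝ} (hindep : iIndepFun (fun t : ℕ => a (t + 1)) P)
    (hlaw : ∀ t : ℕ, 1 ≤ t → HasLaw (a t) (bernoulliMeasure (1 : ℝ) 0 p) P) :
    ∃ (x : ℕ → Ω → ℝ) (K b c : ℝ), c ≠ 0 ∧ (∀ i, Measurable (x i)) ∧ (∀ i ω, |x i ω| ≤ K) ∧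
      iIndepFun x P ∧ (∀ i, ∫ ω, x i ω ∂P = 0) ∧ (∀ i, ∫ ω, x i ω ^ 2 ∂P = 1) ∧
      ∀ᵐ ω ∂P, ∀ t, 1 ≤ t → a t ω = b + c * x (t - 1) ω := by
  have hp0' : (0 : ℝ) < p := hp0
  have hp1' : (p : ℝ) < 1 := hp1
  have hv : (0 : ℝ) < p * (1 - p) := mul_pos hp0' (sub_pos.2 hp1')
  set c : ℝ := √(p * (1 - p)) with hc
  have hc0 : 0 < c := Real.sqrt_pos.2 hv
  have hc2 : c ^ 2 = p * (1 - p) := Real.sq_sqrt hv.le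
  classical
  -- On `{0, 1}` this is `(v - p)/c`; taking only two values, it makes the noise bounded everywhere,
  -- not just almost surely.
  set φ : ℝ → ℝ := fun v => if v = 1 then (1 - p) / c else -p / c with hφ
  have hφm : Measurable φ :=
    Measurable.ite (measurableSet_singleton 1) measurable_const measurable_const
  have ham : ∀ t, AEMeasurable (a (t + 1)) P := fun t => (hlaw (t + 1) (by omega)).aemeasurable
  -- The law gives only a.e. measurability of `a`, so the noise is built from measurable versions.
  have hae : ∀ t, φ ∘ a (t + 1) =ᵐ[P] φ ∘ (ham t).mk := fun t => (ham t).ae_eq_mk.fun_comp φ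
  have hint : ∀ (t : ℕ) (ψ : ℝ → ℝ), Measurable ψ → ∫ ω, ψ ((φ ∘ (ham t).mk) ω) ∂P =
      p * ψ ((1 - p) / c) + (1 - p) * ψ (-p / c) := fun t ψ hψ => by
    calc _ = ∫ ω, ((ψ ∘ φ) ∘ a (t + 1)) ω ∂P :=
          integral_congr_ae ((hae t).symm.fun_comp ψ)
      _ = _ := by
        rw [(hlaw (t + 1) (by omega)).integral_comp (hψ.comp hφm).aestronglyMeasurable,
          integral_bernoulliMeasure]
        simp [hφ]
  refine ⟨fun t => φ ∘ (ham t).mk, 1 / c, p, c, hc0.ne', fun t => hφm.comp (ham t).measurable_mk,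
    fun t ω => ?_, (hindep.comp (fun _ => φ) fun _ => hφm).congr hae, fun t => ?_, fun t => ?_, ?_⟩
  · simp only [Function.comp_apply, hφ]
    split_ifs
    · rw [abs_div, abs_of_pos hc0, abs_of_pos (by linarith)]
      gcongr
      linarith
    · rw [abs_div, abs_of_pos hc0, abs_neg, abs_of_pos hp0']
      gcongr
  · refine (hint t id measurable_id).trans ?_
    simp only [id]
    ring
  · refine (hint t (fun v => v ^ 2) (by fun_prop)).trans ?_
    rw [div_pow, div_pow, hc2]
    have : (1 : ℝ) - p ≠ 0 := by linarith
    field_simp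
    ring
  · have h := ae_all_iff.2 fun t => (hae t).and
      ((hlaw (t + 1) (by omega)).ae_iff (by measurability) |>.2
        (ae_bernoulliMeasure_eq_one_or_zero p))
    filter_upwards [h] with ω hω t ht
    obtain ⟨s, rfl⟩ : ∃ s, t = s + 1 := ⟨t - 1, by omega⟩
    obtain ⟨h1, h2⟩ := hω s
    rw [Nat.add_sub_cancel, ← h1, Function.comp_apply]
    rcases h2 with h2 | h2 <;> rw [h2] <;> simp [hφ] <;> field_simp <;> ring

end Bernoulli

theorem proposition1 {Ω : Type*} [MeasurableSpace Ω] (P : Measure Ω) [IsProbabilityMeasure P]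
    (m : ℕ) (p : unitInterval) (hp0 : 0 < p) (hp1 : p < 1) (a : ℕ → Ω → ℝ)
    (hindep : iIndepFun (fun t : ℕ => a (t + 1)) P)
    (hlaw : ∀ t : ℕ, 1 ≤ t → HasLaw (a t) (bernoulliMeasure (1 : ℝ) 0 p) P) :
    TendstoInDistribution
        (fun (n : ℕ) (ω : Ω) => √(n : ℝ) • autocorrVec m (fun t => a t ω) n)
        atTop (id : EuclideanSpace ℝ (Fin m) → EuclideanSpace ℝ (Fin m)) (fun _ => P)
        (multivariateGaussian 0 (1 : Matrix (Fin m) (Fin m) ℝ)) ∧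
      TendstoInDistribution
        (fun (n : ℕ) (ω : Ω) => portmanteauStat m (fun t => a t ω) n)
        atTop (id : ℝ → ℝ) (fun _ => P) (chiSquaredMeasure m) := by
  obtain ⟨x, K, b, c, hc, hm, hb, hi, h0, h1, hax⟩ :=
    exists_standardized_bernoulli hp0 hp1 hindep hlaw
  have hA : TendstoInDistribution
      (fun (n : ℕ) (ω : Ω) => √(n : ℝ) • autocorrVec m (fun t => a t ω) n)
      atTop (id : EuclideanSpace ℝ (Fin m) → EuclideanSpace ℝ (Fin m)) (fun _ => P)
      (multivariateGaussian 0 (1 : Matrix (Fin m) (Fin m) ℝ)) := by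
    refine (tendstoInDistribution_sqrt_smul_autocorrVec hm hb hi h0 h1).congr (fun n => ?_) .rfl
    filter_upwards [hax] with ω hω
    rw [autocorrVec_affine hc hω]
  refine ⟨hA, ?_⟩
  have hS := hA.continuous_comp (g := fun v => ‖v‖ ^ 2) (by fun_prop)
  simp only [Function.comp_def, ← portmanteauStat_eq_norm_sq] at hS
  -- `hS` has limit variable `‖·‖²` on the Gaussian space; only its law matters, and that is `χ²`.
  refine ⟨hS.forall_aemeasurable, aemeasurable_id, ?_⟩
  convert! hS.tendsto using 2
  refine congrArg nhds (Subtype.ext ?_)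
  exact Measure.map_id.trans (map_norm_sq_multivariateGaussian m).symm
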